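/- Work over $\mathbb{C}$, and let $\mathbb{P}^{55}$ be the projective space of cubic forms in $x_0,\dots,x_5$ up to scalars, so that its points are the cubic fourfolds $X=\{F=0\}\subset\mathbb{P}^5$. For such an $X$ let $$J_X=\Big\{\sum_{i=0}^{5}p_i\frac{\partial F}{\partial x_i}\ \Big|\ p\in\mathbb{C}^6\Big\}$$ be its space of polar quadratic forms. A net of polar quadrics of $X$ is $N=\mathbb{P}(W)$ for a $3$-dimensional subspace $W\subset J_X$, i.e. a point $W$ of the Grassmannian $Gr(3,J_X)$. If $Q_0,Q_1,Q_2$ is a basis of $W$ and $M(Q)$ denotes the symmetric $6\times 6$ coefficient matrix of a quadratic form $Q$, the discriminant curve of $N$ is $$\Delta_N=\{\det(\lambda M(Q_0)+\mu M(Q_1)+\nu M(Q_2))=0\}\subset N\cong\mathbb{P}^2_{[\lambda:\mu:\nu]}.$$ Proposition. For a general smooth cubic fourfold $X$, a general net of polar quadrics of $X$ has a smooth discriminant plane sextic. That is, there is a nonempty Zariski-open subset $U\subset\mathbb{P}^{55}$ such that every $X\in U$ is smooth and, for every $X\in U$, there is a nonempty Zariski-open subset $G_X\subset Gr(3,J_X)$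 such that for every $W\in G_X$, with $N=\mathbb{P}(W)$, the determinant above is a nonzero form of degree $6$ defining a smooth plane curve $\Delta_N$. -/

import Mathlib

open Topology
open scoped LinearAlgebra.Projectivization

noncomputable section

namespace PolarNets

/-! ### Zariski topologies on projective spaces and Grassmannians -/

/-- The Zariski topology on `ℙ(V)`: it is generated by the sets where a homogeneous polynomial
function on `V` does not vanish. A polynomial function is written as a polynomial `P` in the
linear forms on `V`; since `P` is homogeneous, its vanishing at a point of `ℙ(V)` does not depend
on the representative. -/
@[reducible] def zariskiTopology (K V : Type*) [Field K] [AddCommGroup V] [Module K V] :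
    TopologicalSpace (ℙ K V) :=
  TopologicalSpace.generateFrom
    {U | ∃ (d : ℕ) (P : MvPolynomial (Module.Dual K V) K), P.IsHomogeneous d ∧
      U = {x : ℙ K V | MvPolynomial.eval (fun φ : Module.Dual K V => φ x.rep) P ≠ 0}}

/-- The Grassmannian of `k`-dimensional vector subspaces of `V`. -/
def Gr (k : ℕ) (K V : Type*) [Field K] [AddCommGroup V] [Module K V] : Type _ :=
  {W : Submodule K V // Module.Finite K W ∧ Module.finrank K W = k}

theorem ιMulti_ne_zero {K V : Type*} [Field K] [AddCommGroup V] [Module K V] {k : ℕ}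
    {v : Fin k → V} (hv : LinearIndependent K v) : exteriorPower.ιMulti K k v ≠ 0 := by
  have h := (exteriorPower.ιMulti_family_linearIndependent_field (n := k) hv).ne_zero
    (Set.powersetCard.ofFinEmbEquiv (RelEmbedding.refl _))
  simpa [exteriorPower.ιMulti_family] using h

/-- A basis of a `k`-dimensional subspace. -/
def Gr.basis {k : ℕ} {K V : Type*} [Field K] [AddCommGroup V] [Module K V] (W : Gr k K V) :
    Module.Basis (Fin k) K W.1 :=
  haveI := W.2.1
  Module.finBasisOfFinrankEq K W.1 W.2.2

/-- The Plücker map `W = ⟨w₁, …, w_k⟩ ↦ [w₁ ∧ ⋯ ∧ w_k]`, which does not depend on the basis. -/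
def plucker (k : ℕ) (K V : Type*) [Field K] [AddCommGroup V] [Module K V] (W : Gr k K V) :
    ℙ K (⋀[K]^k V) :=
  Projectivization.mk K (exteriorPower.ιMulti K k fun i => (W.basis i : V))
    (ιMulti_ne_zero (W.basis.linearIndependent.map' W.1.subtype W.1.ker_subtype))

/-- The Zariski topology on the Grassmannian, as a subspace of projective space through the
Plücker embedding. -/
@[reducible] def grTopology (k : ℕ) (K V : Type*) [Field K] [AddCommGroup V] [Module K V] :
    TopologicalSpace (Gr k K V) :=
  TopologicalSpace.induced (plucker k K V) (zariskiTopology K (⋀[K]^k V))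

/-! ### Hypersurfaces, polar quadrics and discriminant curves -/

/-- `G = 0` is a smooth hypersurface of degree `d` in `ℙ^{n-1}` over `ℂ` (Jacobian criterion). -/
def IsSmoothHypersurface {n : ℕ} (d : ℕ) (G : MvPolynomial (Fin n) ℂ) : Prop :=
  G.IsHomogeneous d ∧ G ≠ 0 ∧
    ∀ x : Fin n → ℂ, x ≠ 0 → MvPolynomial.eval x G = 0 →
      ∃ i, MvPolynomial.eval x (MvPolynomial.pderiv i G) ≠ 0

/-- The 56-dimensional space of cubic forms in `x₀, …, x₅`; cubic fourfolds are the points of its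
projectivization `ℙ⁵⁵`. -/
abbrev CubicForm : Type :=
  MvPolynomial.homogeneousSubmodule (Fin 6) ℂ 3

/-- The space `J_X = {∑ pᵢ ∂F/∂xᵢ | p ∈ ℂ⁶}` of polar quadratic forms of `X = {F = 0}`. -/
def polarSpace (F : MvPolynomial (Fin 6) ℂ) : Submodule ℂ (MvPolynomial (Fin 6) ℂ) :=
  LinearMap.range (Fintype.linearCombination ℂ fun i => MvPolynomial.pderiv i F)

/-- The symmetric coefficient matrix `M(Q)` of a quadratic form `Q = ∑ M(Q)ᵢⱼ xᵢ xⱼ`. -/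
def quadricMatrix (Q : MvPolynomial (Fin 6) ℂ) : Matrix (Fin 6) (Fin 6) ℂ :=
  Matrix.of fun i j =>
    if i = j then Q.coeff (Finsupp.single i 2)
    else Q.coeff (Finsupp.single i 1 + Finsupp.single j 1) / 2

/-- The discriminant form `det (λ M(Q₀) + μ M(Q₁) + ν M(Q₂)) ∈ ℂ[λ, μ, ν]` of the net of quadrics
generated by `Q₀, Q₁, Q₂`. -/
def discriminantForm (Q : Fin 3 → MvPolynomial (Fin 6) ℂ) : MvPolynomial (Fin 3) ℂ :=
  (∑ k, (MvPolynomial.X k : MvPolynomial (Fin 3) ℂ) •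
    (quadricMatrix (Q k)).map (MvPolynomial.C : ℂ →+* MvPolynomial (Fin 3) ℂ)).det

/-- The discriminant curve of the net `ℙ(W)` of polar quadrics, `W ⊆ J_X`, is a smooth plane
sextic: its equation is taken in the coordinates on `ℙ(W) ≅ ℙ²` given by a basis of `W`,
whichever basis is chosen. -/
def HasSmoothDiscriminantSextic {F : MvPolynomial (Fin 6) ℂ} (W : Gr 3 ℂ (polarSpace F)) : Prop :=
  ∀ b : Module.Basis (Fin 3) ℂ W.1,
    IsSmoothHypersurface 6 (discriminantForm fun k => ((b k : polarSpace F) : MvPolynomial (Fin 6) ℂ))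

end PolarNets

end

/-! Having no singular point is a Zariski-open condition, so one example per condition suffices.
Openness is made explicit in `exists_homogeneousMap_isNonsingular`. If the partials of `D x₀` have
no common zero, the Nullstellensatz puts all monomials of some degree `m` in the ideal they
generate. Freezing the cofactors and varying `x` gives a square coefficient matrix that is the
identity at `x₀`, and wherever its determinant is nonzero, `D x` is nonsingular.

This is applied three times. On cubic forms, the Fermat cubic shows that smoothness is generic, and
`loopCubic` shows that the first three polars generically span a net with nonsingular discriminant;
the two open sets meet, by restriction to a line. For a fixed `F` in both, it is applied on `⋀³
J_X`: `exists_contraction` recovers vectors of a subspace linearly from its Plücker point. The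
result holds for every basis because a linear substitution keeps a form of degree at least 2
nonsingular exactly when its matrix is invertible. -/

noncomputable section

namespace PolarNets

open MvPolynomial

/-! ### Homogeneous polynomial maps -/

section HomogeneousMaps

variable (K V A : Type*) [Field K] [AddCommGroup V] [Module K V] [CommRing A] [Algebra K A]

/-- The polynomial maps `V → A` that are homogeneous of degree `d`. -/
def homogeneousMaps (d : ℕ) : Submodule K (V → A) :=
  Submodule.span K {f | ∃ (φ : Fin d → Module.Dual K V) (a : A), f = fun x => (∏ i, φ i x) • a}

instance : SetLike.GradedMonoid (homogeneousMaps K V A) where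
  one_mem := Submodule.subset_span ⟨Fin.elim0, 1, by ext; simp⟩
  mul_mem := by
    intro i j f g hf hg
    have h := Submodule.mul_mem_mul hf hg
    rw [homogeneousMaps, homogeneousMaps, Submodule.span_mul_span] at h
    refine Submodule.span_mono ?_ h
    rintro _ ⟨_, ⟨φ, a, rfl⟩, _, ⟨ψ, b, rfl⟩, rfl⟩
    refine ⟨Fin.append φ ψ, a * b, ?_⟩
    ext x
    simp [Fin.prod_univ_add, mul_smul_mul_comm]

variable {K V A}

theorem linear_mem_homogeneousMaps [FiniteDimensional K V] {f : V → A} (hf : IsLinearMap K f) :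
    f ∈ homogeneousMaps K V A 1 := by
  let b := Module.finBasis K V
  have h : f = ∑ i, fun x => (∏ _j : Fin 1, b.coord i x) • f (b i) := by
    ext x
    have h' := map_sum (hf.mk' f) (fun i => b.repr x i • b i) Finset.univ
    rw [b.sum_repr] at h'
    simpa using h'
  rw [h]
  exact Submodule.sum_mem _ fun i _ => Submodule.subset_span ⟨fun _ => b.coord i, f (b i), rfl⟩

theorem comp_mem_homogeneousMaps {B : Type*} [CommRing B] [Algebra K B] (g : A →ₗ[K] B) {d : ℕ}
    {f : V → A} (hf : f ∈ homogeneousMaps K V A d) :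
    (fun x => g (f x)) ∈ homogeneousMaps K V B d := by
  induction hf using Submodule.span_induction with
  | mem f hf =>
    obtain ⟨φ, a, rfl⟩ := hf
    exact Submodule.subset_span ⟨φ, g a, by ext; simp⟩
  | zero => simp only [Pi.zero_apply, map_zero]; exact Submodule.zero_mem _
  | add f₁ f₂ _ _ h₁ h₂ =>
    simp only [Pi.add_apply, map_add]
    exact Submodule.add_mem _ h₁ h₂
  | smul a f _ h =>
    simp only [Pi.smul_apply, map_smul]
    exact Submodule.smul_mem _ a h

theorem det_mem_homogeneousMaps {n : Type*} [Fintype n] [DecidableEq n] {d : ℕ}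
    {M : V → Matrix n n A} (hM : ∀ i j, (fun x => M x i j) ∈ homogeneousMaps K V A d) :
    (fun x => (M x).det) ∈ homogeneousMaps K V A (∑ _i : n, d) := by
  have h : (fun x => (M x).det) = ∑ σ : Equiv.Perm n,
      Equiv.Perm.sign σ • ∏ i, fun x => M x (σ i) i := by
    ext x
    simp [Matrix.det_apply]
  rw [h]
  refine Submodule.sum_mem _ fun σ _ => ?_
  have h' := SetLike.prod_mem_graded (homogeneousMaps K V A) (F := Finset.univ) (fun _ : n => d)
    (fun i x => M x (σ i) i) fun i _ => hM _ _
  rcases Int.units_eq_one_or (Equiv.Perm.sign σ) with h | h <;> rw [h]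
  · simpa using h'
  · simpa using Submodule.neg_mem _ h'

theorem homogeneousMaps_smul {d : ℕ} {f : V → A} (hf : f ∈ homogeneousMaps K V A d) (a : K)
    (x : V) : f (a • x) = a ^ d • f x := by
  induction hf using Submodule.span_induction with
  | mem f hf =>
    obtain ⟨φ, b, rfl⟩ := hf
    simp [Finset.prod_mul_distrib, mul_smul]
  | zero => simp
  | add f₁ f₂ _ _ h₁ h₂ => simp [h₁, h₂]
  | smul c f _ h => simp [h, smul_comm c]

theorem exists_eval_eq_of_mem_homogeneousMaps {d : ℕ} {f : V → K}
    (hf : f ∈ homogeneousMaps K V K d) :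
    ∃ P : MvPolynomial (Module.Dual K V) K, P.IsHomogeneous d ∧
      ∀ x, f x = eval (fun φ : Module.Dual K V => φ x) P := by
  induction hf using Submodule.span_induction with
  | mem f hf =>
    obtain ⟨φ, b, rfl⟩ := hf
    refine ⟨C b * ∏ i, X (φ i), ?_, fun x => by simp [mul_comm]⟩
    have := IsHomogeneous.prod Finset.univ (fun i => (X (φ i) : MvPolynomial (Module.Dual K V) K))
      (fun _ => 1) fun i _ => isHomogeneous_X _ _
    simpa using this.C_mul b
  | zero => exact ⟨0, isHomogeneous_zero _ _ _, by simp⟩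
  | add f₁ f₂ _ _ h₁ h₂ =>
    obtain ⟨P, hP, h₁⟩ := h₁
    obtain ⟨Q, hQ, h₂⟩ := h₂
    exact ⟨P + Q, hP.add hQ, by simp [h₁, h₂]⟩
  | smul c f _ h =>
    obtain ⟨P, hP, h⟩ := h
    exact ⟨C c * P, hP.C_mul c, by simp [h]⟩

theorem isOpen_setOf_rep_ne_zero {d : ℕ} {f : V → K} (hf : f ∈ homogeneousMaps K V K d) :
    IsOpen[zariskiTopology K V] {x : ℙ K V | f x.rep ≠ 0} := by
  obtain ⟨P, hP, h⟩ := exists_eval_eq_of_mem_homogeneousMaps hf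
  exact TopologicalSpace.isOpen_generateFrom_of_mem ⟨d, P, hP, by simp [h]⟩

theorem rep_mk_ne_zero_iff {d : ℕ} {f : V → K} (hf : f ∈ homogeneousMaps K V K d) {x : V}
    (hx : x ≠ 0) : f (Projectivization.mk K x hx).rep ≠ 0 ↔ f x ≠ 0 := by
  obtain ⟨a, ha⟩ := Projectivization.exists_smul_eq_mk_rep K x hx
  rw [← ha, Units.smul_def, homogeneousMaps_smul hf]
  simp

/-- Two homogeneous polynomial functions that are not identically zero have a common point of
non-vanishing. -/
theorem exists_ne_zero_and_ne_zero [Infinite K] {d e : ℕ} {f g : V → K}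
    (hf : f ∈ homogeneousMaps K V K d) (hg : g ∈ homogeneousMaps K V K e) {x y : V}
    (hx : f x ≠ 0) (hy : g y ≠ 0) : ∃ z, f z ≠ 0 ∧ g z ≠ 0 := by
  -- On the line from `x` to `y` both functions become univariate polynomials, nonzero because of
  -- their values at `t = 0` and `t = 1` respectively.
  have key : ∀ {d : ℕ} {f : V → K}, f ∈ homogeneousMaps K V K d →
      ∃ p : Polynomial K, ∀ t, p.eval t = f (x + t • (y - x)) := by
    intro d f hf
    obtain ⟨P, -, h⟩ := exists_eval_eq_of_mem_homogeneousMaps hf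
    refine ⟨aeval (fun φ => Polynomial.C (φ x) + Polynomial.X * Polynomial.C (φ (y - x))) P,
      fun t => ?_⟩
    rw [h, ← Polynomial.coe_aeval_eq_eval, ← AlgHom.comp_apply, comp_aeval, ← coe_aeval_eq_eval]
    simp
  obtain ⟨p, hp⟩ := key hf
  obtain ⟨q, hq⟩ := key hg
  have hp0 : p ≠ 0 := by
    rintro rfl
    exact hx (by simpa using (hp 0).symm)
  have hq0 : q ≠ 0 := by
    rintro rfl
    exact hy (by simpa using (hq 1).symm)
  obtain ⟨t, ht⟩ : ∃ t, (p * q).eval t ≠ 0 := by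
    by_contra! h
    exact mul_ne_zero hp0 hq0 (Polynomial.funext fun t => by simpa using h t)
  rw [Polynomial.eval_mul, hp, hq] at ht
  exact ⟨_, left_ne_zero_of_mul ht, right_ne_zero_of_mul ht⟩

end HomogeneousMaps

/-! ### Nonsingular forms -/

section Nonsingular

variable {K : Type*} [Field K] {n : ℕ}

/-- The partial derivatives of `D` have no common zero apart from the origin. -/
def IsNonsingular (D : MvPolynomial (Fin n) K) : Prop :=
  ∀ y : Fin n → K, y ≠ 0 → ∃ i, eval y (pderiv i D) ≠ 0

theorem isHomogeneous_pderiv {σ : Type*} {d : ℕ} {D : MvPolynomial σ K}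
    (hD : D.IsHomogeneous (d + 1)) (i : σ) : (pderiv i D).IsHomogeneous d := by
  classical
  intro m hm
  rw [coeff_pderiv] at hm
  have h := hD (left_ne_zero_of_mul hm)
  rw [map_add, Finsupp.weight_single] at h
  simpa using h

/-- Nullstellensatz: the partials vanish together at most at the origin, where every coordinate
vanishes too. -/
theorem IsNonsingular.exists_X_pow_mem [IsAlgClosed K] {D : MvPolynomial (Fin n) K}
    (hD : IsNonsingular D) :
    ∃ N : ℕ, ∀ i, (X i : MvPolynomial (Fin n) K) ^ N ∈
      Ideal.span (Set.range fun j => pderiv j D) := by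
  set J := Ideal.span (Set.range fun j => pderiv j D)
  have h : ∀ i, (X i : MvPolynomial (Fin n) K) ∈ J.radical := by
    intro i
    rw [← vanishingIdeal_zeroLocus_eq_radical (K := K), mem_vanishingIdeal_iff]
    intro y hy
    by_contra hne
    obtain ⟨j, hj⟩ := hD y (by rintro rfl; simp at hne)
    exact hj (by simpa [aeval_eq_eval] using hy _ (Ideal.subset_span ⟨j, rfl⟩))
  choose N hN using h
  exact ⟨∑ i, N i, fun i => J.pow_mem_of_pow_mem (hN i)
    (Finset.single_le_sum (fun _ _ => Nat.zero_le _) (Finset.mem_univ i))⟩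

/-- Pigeonhole: a monomial of degree greater than `n * N` has some exponent at least `N`. -/
theorem IsNonsingular.exists_monomial_mem [IsAlgClosed K] {D : MvPolynomial (Fin n) K}
    (hD : IsNonsingular D) :
    ∃ M : ℕ, ∀ m, M < m → ∀ s : Fin n →₀ ℕ, s.degree = m →
      monomial s (1 : K) ∈ Ideal.span (Set.range fun j => pderiv j D) := by
  obtain ⟨N, hN⟩ := hD.exists_X_pow_mem
  refine ⟨n * N, fun m hm s hs => ?_⟩
  obtain ⟨i, hi⟩ : ∃ i, N ≤ s i := by
    by_contra! h
    have h' := Finset.sum_le_card_nsmul Finset.univ s N fun i _ => (h i).le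
    rw [← Finsupp.degree_eq_sum, hs] at h'
    simp at h'
    omega
  have h : monomial s (1 : K) = monomial (s - Finsupp.single i N) 1 * X i ^ N := by
    rw [X_pow_eq_monomial, monomial_mul, tsub_add_cancel_of_le (by simpa using hi), mul_one]
  rw [h]
  exact Ideal.mul_mem_left _ _ (hN i)

-- Since each `p i` is homogeneous of degree `d`, only the degree `m - d` part of each cofactor
-- contributes in degree `m`.
attribute [local instance] MvPolynomial.gradedAlgebra in
theorem exists_isHomogeneous_sum_eq {d m : ℕ} (hdm : d ≤ m) {ι σ : Type*} [Fintype ι]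
    {p : ι → MvPolynomial σ K} (hp : ∀ i, (p i).IsHomogeneous d) {q : MvPolynomial σ K}
    (hq : q.IsHomogeneous m) (h : q ∈ Ideal.span (Set.range p)) :
    ∃ g : ι → MvPolynomial σ K, (∀ i, (g i).IsHomogeneous (m - d)) ∧ ∑ i, g i * p i = q := by
  obtain ⟨g, hg⟩ := Ideal.mem_span_range_iff_exists_fun.1 h
  refine ⟨fun i => homogeneousComponent (m - d) (g i),
    fun i => homogeneousComponent_isHomogeneous _ _, ?_⟩
  rw [← homogeneousComponent_eq_self hq, ← hg, map_sum]
  refine Finset.sum_congr rfl fun i _ => ?_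
  have hc (q : MvPolynomial σ K) (j : ℕ) :
      (DirectSum.decompose (homogeneousSubmodule σ K) q j : MvPolynomial σ K) =
        homogeneousComponent j q := decomposition.decompose'_apply q j
  have := DirectSum.coe_decompose_mul_of_right_mem_of_le (homogeneousSubmodule σ K)
    (a := g i) (hp i) hdm
  rw [hc, hc] at this
  exact this.symm

theorem exists_homogeneousMap_isNonsingular [IsAlgClosed K] {V : Type*} [AddCommGroup V]
    [Module K V] {d e : ℕ} {D : V → MvPolynomial (Fin n) K}
    (hD : D ∈ homogeneousMaps K V (MvPolynomial (Fin n) K) e)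
    (hom : ∀ x, (D x).IsHomogeneous (d + 1)) {x₀ : V} (h₀ : IsNonsingular (D x₀)) :
    ∃ (k : ℕ) (f : V → K), f ∈ homogeneousMaps K V K k ∧ f x₀ ≠ 0 ∧
      ∀ x, f x ≠ 0 → IsNonsingular (D x) := by
  classical
  obtain ⟨M, hM⟩ := h₀.exists_monomial_mem
  obtain ⟨m, hMm, hdm⟩ : ∃ m, M < m ∧ d ≤ m := ⟨M + d + 1, by omega, by omega⟩
  let S := (Finsupp.finite_of_degree_eq (σ := Fin n) m).toFinset
  have hS : ∀ s, s ∈ S ↔ s.degree = m := by simp [S]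
  choose g hg hgs using fun s : S => exists_isHomogeneous_sum_eq hdm
    (fun i => isHomogeneous_pderiv (hom x₀) i) (isHomogeneous_monomial (1 : K) ((hS _).1 s.2))
    (hM m hMm s ((hS _).1 s.2))
  -- The cofactors `g` stay those found at `x₀`, so the dependence on `x` is only through `D x` and
  -- remains homogeneous of degree `e`.
  let B : V → S → MvPolynomial (Fin n) K := fun x s => ∑ i, g s i * pderiv i (D x)
  have hB : ∀ x s, (B x s).IsHomogeneous m := fun x s => IsHomogeneous.sum _ _ _ fun i _ => by
    simpa [hdm] using (hg s i).mul (isHomogeneous_pderiv (hom x) i)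
  let A : V → Matrix S S K := fun x => Matrix.of fun s t => coeff t.1 (B x s)
  have hA : ∀ s t, (fun x => A x s t) ∈ homogeneousMaps K V K e := fun s t =>
    by simpa [A, B, coeff_sum] using comp_mem_homogeneousMaps (lcoeff K t.1 ∘ₗ
      ∑ i, LinearMap.mulLeft K (g s i) ∘ₗ (pderiv i).toLinearMap) hD
  have hA₀ : A x₀ = 1 := by
    ext s t
    simp [A, B, hgs, coeff_monomial, Matrix.one_apply]
  refine ⟨_, _, det_mem_homogeneousMaps hA, by simp [hA₀], fun x hx y hy => ?_⟩
  by_contra! h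
  refine hy (funext fun i => ?_)
  -- At a common zero `y` of the partials each `B x s` vanishes, so `A x` kills the vector of degree
  -- `m` monomials at `y`. Invertibility then gives `y i ^ m = 0`.
  have hv : (A x).mulVec (fun t => ∏ j, y j ^ t.1 j) = 0 := by
    ext s
    have h0 : eval y (B x s) = 0 := by simp [B, h]
    have hsub : (B x s).support ⊆ S := fun t ht => (hS t).2 <| by
      by_contra hne
      exact mem_support_iff.1 ht ((hB x s).coeff_eq_zero hne)
    rw [eval_eq', Finset.sum_subset hsub fun t _ ht => by
      rw [notMem_support_iff.1 ht, zero_mul], ← Finset.sum_coe_sort] at h0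
    exact h0
  have hv' := congrFun (Matrix.eq_zero_of_mulVec_eq_zero hx hv)
    ⟨Finsupp.single i m, by simp [hS]⟩
  rw [Finset.prod_eq_single i (by intro j _ hj; simp [hj.symm]) (by simp)] at hv'
  exact eq_zero_of_pow_eq_zero (n := m) (by simpa using hv')

end Nonsingular

/-! ### Nonsingularity under linear substitution. -/

section LinearSubstitution

variable {K : Type*} [Field K] {n : ℕ}

/-- The form `D(Aᵀ λ)` obtained from `D(λ)` by a linear substitution. -/
def linearSubst (A : Matrix (Fin n) (Fin n) K) (D : MvPolynomial (Fin n) K) :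
    MvPolynomial (Fin n) K :=
  aeval (fun j => ∑ k, C (A k j) * X k) D

theorem eval_linearSubst (A : Matrix (Fin n) (Fin n) K) (D : MvPolynomial (Fin n) K)
    (z : Fin n → K) : eval z (linearSubst A D) = eval (Matrix.vecMul z A) D := by
  have h : (aeval z : MvPolynomial (Fin n) K →ₐ[K] K) (linearSubst A D) =
      aeval (Matrix.vecMul z A) D := by
    rw [linearSubst, ← AlgHom.comp_apply, comp_aeval]
    congr 2
    ext j
    simp [Matrix.vecMul, dotProduct, mul_comm]
  simpa [aeval_eq_eval] using h

theorem eval_pderiv_linearSubst (A : Matrix (Fin n) (Fin n) K) (D : MvPolynomial (Fin n) K)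
    (z : Fin n → K) (k : Fin n) :
    eval z (pderiv k (linearSubst A D)) =
      ∑ j, A k j * eval (Matrix.vecMul z A) (pderiv j D) := by
  induction D using MvPolynomial.induction_on with
  | C a => simp [linearSubst]
  | add p q hp hq =>
    have : linearSubst A (p + q) = linearSubst A p + linearSubst A q := map_add _ _ _
    simp [this, hp, hq, mul_add, Finset.sum_add_distrib]
  | mul_X p i hp =>
    have : linearSubst A (p * X i) = linearSubst A p * ∑ k, C (A k i) * X k := by
      simp [linearSubst]
    have hv : ∑ x, A x i * z x = Matrix.vecMul z A i := by
      simp [Matrix.vecMul, dotProduct, mul_comm]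
    rw [this, Derivation.leibniz]
    simp [Derivation.leibniz, hp, eval_linearSubst, pderiv_X, Pi.single_apply, hv, mul_add,
      Finset.sum_add_distrib, Finset.mul_sum, apply_ite]
    rw [mul_comm, add_right_inj]
    exact Finset.sum_congr rfl fun j _ => by ring

/-- By the chain rule the new gradient at `z` is `A` times the old one at `z A`. A left kernel
vector of `A` is sent to the origin, where the gradient vanishes because the degree is at least 2.
-/
theorem isNonsingular_linearSubst_iff {d : ℕ} {D : MvPolynomial (Fin n) K}
    (hD : D.IsHomogeneous (d + 2)) (A : Matrix (Fin n) (Fin n) K) :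
    IsNonsingular (linearSubst A D) ↔ A.det ≠ 0 ∧ IsNonsingular D := by
  constructor
  · intro h
    have hdet : A.det ≠ 0 := by
      intro hA
      obtain ⟨z, hz, hzA⟩ := Matrix.exists_vecMul_eq_zero_iff.2 hA
      obtain ⟨k, hk⟩ := h z hz
      refine hk ?_
      rw [eval_pderiv_linearSubst, hzA]
      refine Finset.sum_eq_zero fun j _ => ?_
      have h0 := (isHomogeneous_pderiv hD j).coeff_eq_zero (d := 0) (by simp)
      rw [← constantCoeff_eq, ← eval_zero] at h0
      rw [h0, mul_zero]
    refine ⟨hdet, fun y hy => ?_⟩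
    have hu : IsUnit A := (Matrix.isUnit_iff_isUnit_det A).2 hdet.isUnit
    obtain ⟨z, rfl⟩ := Matrix.vecMul_surjective_iff_isUnit.2 hu y
    obtain ⟨k, hk⟩ := h z (by rintro rfl; simp at hy)
    rw [eval_pderiv_linearSubst] at hk
    obtain ⟨j, -, hj⟩ := Finset.exists_ne_zero_of_sum_ne_zero hk
    exact ⟨j, right_ne_zero_of_mul hj⟩
  · rintro ⟨hdet, h⟩ z hz
    by_contra! hk
    obtain ⟨j, hj⟩ := h (Matrix.vecMul z A) fun h0 =>
      hz (Matrix.eq_zero_of_vecMul_eq_zero hdet h0)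
    refine hj (congrFun (Matrix.eq_zero_of_mulVec_eq_zero hdet
      (v := fun j => eval (Matrix.vecMul z A) (pderiv j D)) ?_) j)
    ext k
    rw [Pi.zero_apply, ← hk k, eval_pderiv_linearSubst]
    rfl

end LinearSubstitution

/-! ### Discriminant forms of nets and their behaviour under change of generators. -/

section Discriminant

/-- The coefficient matrix of a quadratic form, as a linear map. -/
def quadricMatrixₗ : MvPolynomial (Fin 6) ℂ →ₗ[ℂ] Matrix (Fin 6) (Fin 6) ℂ where
  toFun := quadricMatrix
  map_add' P Q := by
    ext i j
    simp only [quadricMatrix, Matrix.of_apply, Matrix.add_apply, coeff_add]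
    split_ifs <;> ring
  map_smul' a Q := by
    ext i j
    simp only [quadricMatrix, Matrix.of_apply, Matrix.smul_apply, coeff_smul, RingHom.id_apply,
      smul_eq_mul]
    split_ifs <;> ring

theorem quadricMatrixₗ_apply (Q : MvPolynomial (Fin 6) ℂ) :
    quadricMatrixₗ Q = quadricMatrix Q := rfl

theorem eval_discriminantForm (Q : Fin 3 → MvPolynomial (Fin 6) ℂ) (y : Fin 3 → ℂ) :
    eval y (discriminantForm Q) = (quadricMatrix (∑ k, y k • Q k)).det := by
  rw [discriminantForm, RingHom.map_det]
  congr 1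
  ext i j
  simp only [← quadricMatrixₗ_apply, map_sum, map_smul, Matrix.sum_apply]
  simp

theorem discriminantForm_entry (Q : Fin 3 → MvPolynomial (Fin 6) ℂ) (i j : Fin 6) :
    (∑ k, (X k : MvPolynomial (Fin 3) ℂ) •
      (quadricMatrix (Q k)).map (C : ℂ →+* MvPolynomial (Fin 3) ℂ)) i j =
        ∑ k, quadricMatrixₗ (Q k) i j • (X k : MvPolynomial (Fin 3) ℂ) := by
  simp [Matrix.sum_apply, quadricMatrixₗ_apply, smul_eq_C_mul, mul_comm]

theorem isHomogeneous_discriminantForm (Q : Fin 3 → MvPolynomial (Fin 6) ℂ) :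
    (discriminantForm Q).IsHomogeneous 6 := by
  rw [discriminantForm, Matrix.det_apply]
  refine IsHomogeneous.sum _ _ _ fun σ _ => ?_
  have h := IsHomogeneous.prod Finset.univ (fun i => (∑ k, (X k : MvPolynomial (Fin 3) ℂ) •
      (quadricMatrix (Q k)).map (C : ℂ →+* MvPolynomial (Fin 3) ℂ)) (σ i) i) (fun _ => 1)
    fun i _ => by
      rw [discriminantForm_entry]
      exact IsHomogeneous.sum _ _ _ fun k _ => by
        rw [smul_eq_C_mul]
        exact isHomogeneous_C_mul_X _ _
  rcases Int.units_eq_one_or (Equiv.Perm.sign σ) with h' | h' <;> rw [h']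
  · simpa using h
  · simpa using h.neg

theorem discriminantForm_mem_homogeneousMaps {V : Type*} [AddCommGroup V] [Module ℂ V]
    [FiniteDimensional ℂ V] (L : Fin 3 → V →ₗ[ℂ] MvPolynomial (Fin 6) ℂ) :
    (fun x => discriminantForm fun k => L k x) ∈
      homogeneousMaps ℂ V (MvPolynomial (Fin 3) ℂ) (∑ _i : Fin 6, 1) := by
  refine det_mem_homogeneousMaps fun i j => linear_mem_homogeneousMaps ?_
  simp only [discriminantForm_entry]
  constructor
  · intro x y
    simp [add_smul, Finset.sum_add_distrib]
  · intro c x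
    simp [mul_smul, Finset.smul_sum]

theorem discriminantForm_sum_smul (A : Matrix (Fin 3) (Fin 3) ℂ)
    (Q : Fin 3 → MvPolynomial (Fin 6) ℂ) :
    discriminantForm (fun k => ∑ j, A k j • Q j) = linearSubst A (discriminantForm Q) := by
  refine MvPolynomial.funext fun y => ?_
  rw [eval_linearSubst, eval_discriminantForm, eval_discriminantForm]
  congr 2
  simp only [Finset.smul_sum, smul_smul, Matrix.vecMul, dotProduct, Finset.sum_smul]
  exact Finset.sum_comm

theorem isNonsingular_discriminantForm_sum_smul_iff (A : Matrix (Fin 3) (Fin 3) ℂ)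
    (Q : Fin 3 → MvPolynomial (Fin 6) ℂ) :
    IsNonsingular (discriminantForm fun k => ∑ j, A k j • Q j) ↔
      A.det ≠ 0 ∧ IsNonsingular (discriminantForm Q) := by
  rw [discriminantForm_sum_smul]
  exact isNonsingular_linearSubst_iff (isHomogeneous_discriminantForm Q) A

theorem linearIndependent_of_isNonsingular_discriminantForm {Q : Fin 3 → MvPolynomial (Fin 6) ℂ}
    (hQ : IsNonsingular (discriminantForm Q)) : LinearIndependent ℂ Q := by
  rw [Fintype.linearIndependent_iff]
  intro z hz
  by_contra! h
  obtain ⟨k₀, hk₀⟩ := h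
  -- The relation `z` makes `A` fix the triple `Q`, while `z A = 0`; so `A` is singular, yet the
  -- discriminant obtained through it is nonsingular.
  let A : Matrix (Fin 3) (Fin 3) ℂ := 1 - Matrix.vecMulVec (Pi.single k₀ (z k₀)⁻¹) z
  have hA : (fun k => ∑ j, A k j • Q j) = Q := by
    ext1 k
    simp only [A, Matrix.sub_apply, Matrix.vecMulVec_apply, sub_smul, Finset.sum_sub_distrib,
      mul_smul, ← Finset.smul_sum, hz, smul_zero, sub_zero]
    simp [Matrix.one_apply]
  rw [← hA] at hQ
  refine ((isNonsingular_discriminantForm_sum_smul_iff A Q).1 hQ).1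
    (Matrix.exists_vecMul_eq_zero_iff.1 ⟨z, fun h => hk₀ (congrFun h k₀), ?_⟩)
  simp [A, Matrix.vecMul_sub, Matrix.vecMul_vecMulVec, hk₀]

theorem IsNonsingular.isSmoothHypersurface {n d : ℕ} {D : MvPolynomial (Fin (n + 1)) ℂ}
    (h : IsNonsingular D) (hD : D.IsHomogeneous d) : IsSmoothHypersurface d D := by
  refine ⟨hD, ?_, fun x hx _ => h x hx⟩
  rintro rfl
  obtain ⟨i, hi⟩ := h 1 one_ne_zero
  simp at hi

/-- Writing the `Q k` in the basis `b` presents their discriminant as a linear substitution of that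
of `b`. -/
theorem isNonsingular_discriminantForm_basis {F : MvPolynomial (Fin 6) ℂ}
    {W : Submodule ℂ (polarSpace F)} {Q : Fin 3 → polarSpace F} (hQW : ∀ k, Q k ∈ W)
    (hQ : IsNonsingular (discriminantForm fun k => (Q k : MvPolynomial (Fin 6) ℂ)))
    (b : Module.Basis (Fin 3) ℂ W) :
    IsNonsingular (discriminantForm fun k => ((b k : polarSpace F) : MvPolynomial (Fin 6) ℂ)) := by
  refine ((isNonsingular_discriminantForm_sum_smul_iff
    (Matrix.of fun k j => b.repr ⟨Q k, hQW k⟩ j) _).1 ?_).2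
  convert hQ using 2
  ext1 k
  have h := congrArg (fun w : W => ((w : polarSpace F) : MvPolynomial (Fin 6) ℂ))
    (b.sum_repr ⟨Q k, hQW k⟩)
  simpa only [Submodule.coe_sum, Submodule.coe_smul, Matrix.of_apply] using h

end Discriminant

/-! ### Recovering vectors of a subspace from its Plücker point. -/

section Contraction

variable {K V : Type*} [Field K] [AddCommGroup V] [Module K V] {k : ℕ}

theorem prod_smul_update (φ : Fin k → Module.Dual K V) (i : Fin k)
    (v : Fin k → V) (j : Fin k) (x : V) :
    (∏ l ∈ Finset.univ.erase i, φ l (Function.update v j x l)) • Function.update v j x i =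
      if j = i then (∏ l ∈ Finset.univ.erase i, φ l (v l)) • x
      else (φ j x * ∏ l ∈ (Finset.univ.erase i) \ {j}, φ l (v l)) • v i := by
  have h : (fun l => φ l (Function.update v j x l)) =
      Function.update (fun l => φ l (v l)) j (φ j x) :=
    funext fun l => Function.apply_update (fun l => φ l) v j x l
  rw [show ∏ l ∈ Finset.univ.erase i, φ l (Function.update v j x l) =
    ∏ l ∈ Finset.univ.erase i, Function.update (fun l => φ l (v l)) j (φ j x) l by rw [← h]]
  split_ifs with hj
  · subst hj
    rw [Finset.prod_update_of_notMem (by simp), Function.update_self]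
  · convert rfl using 2
    · rw [← Finset.prod_update_of_mem (by simp [hj])]
    · rw [Function.update_of_ne (Ne.symm hj)]

/-- The multilinear map `v ↦ (∏_{j ≠ i} φⱼ(vⱼ)) vᵢ`. -/
def slotMap (φ : Fin k → Module.Dual K V) (i : Fin k) :
    MultilinearMap K (fun _ : Fin k => V) V where
  toFun v := (∏ j ∈ Finset.univ.erase i, φ j (v j)) • v i
  map_update_add' := by
    intro inst v j x y
    obtain rfl := Subsingleton.elim inst (instDecidableEqFin k)
    rw [prod_smul_update, prod_smul_update, prod_smul_update]
    split_ifs with h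
    · rw [smul_add]
    · rw [map_add, add_mul, add_smul]
  map_update_smul' := by
    intro inst v j c x
    obtain rfl := Subsingleton.elim inst (instDecidableEqFin k)
    rw [prod_smul_update, prod_smul_update]
    split_ifs with h
    · rw [smul_comm]
    · rw [map_smul, smul_eq_mul, mul_assoc, mul_smul]

/-- With functionals `φ j` dual to `b`, contract with all of them but `φ i`, by alternatizing
`slotMap φ i`. Every term is a multiple of some `v j`. On `b` only the identity permutation
survives: any other one moves some `j ≠ i`, giving a factor `φ j (b (σ j)) = 0`. -/
theorem exists_contraction {b : Fin k → V} (hb : LinearIndependent K b) :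
    ∃ c : Fin k → ⋀[K]^k V →ₗ[K] V,
      (∀ i v, c i (exteriorPower.ιMulti K k v) ∈ Submodule.span K (Set.range v)) ∧
      ∀ i, c i (exteriorPower.ιMulti K k b) = b i := by
  obtain ⟨g, hg⟩ := (Fintype.linearCombination K b).exists_leftInverse_of_injective
    (LinearMap.ker_eq_bot.2 (linearIndependent_iff_injective_fintypeLinearCombination.1 hb))
  let φ : Fin k → Module.Dual K V := fun i => LinearMap.proj i ∘ₗ g
  have hφ : ∀ i j, φ i (b j) = if i = j then 1 else 0 := by
    intro i j
    have h := LinearMap.congr_fun hg (Pi.single j 1)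
    simp [Fintype.linearCombination_apply_single] at h
    simp [φ, h, Pi.single_apply]
  refine ⟨fun i => exteriorPower.alternatingMapLinearEquiv (slotMap φ i).alternatization,
    fun i v => ?_, fun i => ?_⟩
  · rw [exteriorPower.alternatingMapLinearEquiv_apply_ιMulti,
      MultilinearMap.alternatization_apply]
    refine Submodule.sum_mem _ fun σ _ => ?_
    have h : (slotMap φ i).domDomCongr σ v ∈ Submodule.span K (Set.range v) :=
      Submodule.smul_mem _ _ (Submodule.subset_span ⟨_, rfl⟩)
    rcases Int.units_eq_one_or (Equiv.Perm.sign σ) with h' | h' <;> rw [h']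
    · simpa using h
    · simpa using h
  · rw [exteriorPower.alternatingMapLinearEquiv_apply_ιMulti,
      MultilinearMap.alternatization_apply, Finset.sum_eq_single 1]
    · simp [slotMap, hφ]
    · intro σ _ hσ
      obtain ⟨j, hji, hj⟩ : ∃ j, j ≠ i ∧ σ j ≠ j := by
        by_contra! h
        refine hσ (Equiv.ext fun j => ?_)
        by_cases hji : j = i
        · subst hji
          by_contra hne
          exact hne (σ.injective (h _ hne))
        · exact h j hji
      have h : (slotMap φ i).domDomCongr σ b = 0 := by
        change (∏ l ∈ Finset.univ.erase i, φ l (b (σ l))) • b (σ i) = 0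
        rw [Finset.prod_eq_zero (i := j) (by simp [hji]) (by simp [hφ, hj.symm]), zero_smul]
      rw [h, smul_zero]
    · simp

end Contraction

/-! ### Explicit cubics: a loop-type discriminant and the Fermat cubic. -/

section Example

theorem quadricMatrix_X_mul_X (a b : Fin 6) :
    quadricMatrix (X a * X b) = Matrix.of fun i j =>
      ((if i = a ∧ j = b then 1 else 0) + (if i = b ∧ j = a then 1 else 0) : ℂ) / 2 := by
  have hX : (X a * X b : MvPolynomial (Fin 6) ℂ) =
      monomial (Finsupp.single a 1 + Finsupp.single b 1) 1 := by
    simp [X, monomial_mul]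
  have hab : ∀ i j : Fin 6, Finsupp.single a 1 + Finsupp.single b 1 =
      Finsupp.single i 1 + Finsupp.single j 1 ↔ (i = a ∧ j = b) ∨ (i = b ∧ j = a) := by
    intro i j
    constructor
    · intro h
      have ha := DFunLike.congr_fun h a
      have hb := DFunLike.congr_fun h b
      simp only [Finsupp.add_apply, Finsupp.single_apply] at ha hb
      grind
    · rintro (⟨rfl, rfl⟩ | ⟨rfl, rfl⟩)
      · rfl
      · rw [add_comm]
  ext i j
  simp only [quadricMatrix, Matrix.of_apply, hX, coeff_monomial]
  have h2 : (Finsupp.single i 2 : Fin 6 →₀ ℕ) = Finsupp.single i 1 + Finsupp.single i 1 := by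
    rw [← Finsupp.single_add]
  simp only [h2, hab]
  by_cases hij : i = j
  · subst hij
    by_cases h : i = a ∧ i = b
    · simp [h.1.symm, h.2.symm]
    · simp [h, and_comm]
  · rw [if_neg hij]
    by_cases h₁ : i = a ∧ j = b
    · have : ¬ (i = b ∧ j = a) := by grind
      simp [h₁]
      grind
    · simp [h₁]

/-- A cubic form whose first three polars generate a net with discriminant
`4 λ⁵ μ + 2 μ⁵ ν + 2 ν⁵ λ`. -/
def loopCubic : MvPolynomial (Fin 6) ℂ :=
  C 2 * (X 0 * X 1 * X 2) + (C 2 * (X 0 ^ 2 * X 3) + X 1 ^ 2 * X 4 + X 2 ^ 2 * X 5) +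
    (X 0 * X 4 ^ 2 + X 1 * X 5 ^ 2 + C 2 * (X 2 * X 3 ^ 2))

theorem isHomogeneous_loopCubic : loopCubic.IsHomogeneous 3 := by
  have h1 : ∀ i : Fin 6, (X i : MvPolynomial (Fin 6) ℂ).IsHomogeneous 1 :=
    fun i => isHomogeneous_X _ i
  have h2 : ∀ i : Fin 6, (X i ^ 2 : MvPolynomial (Fin 6) ℂ).IsHomogeneous 2 :=
    fun i => isHomogeneous_X_pow i 2
  exact (((((h1 0).mul (h1 1)).mul (h1 2)).C_mul 2).add
    (((((h2 0).mul (h1 3)).C_mul 2).add ((h2 1).mul (h1 4))).add ((h2 2).mul (h1 5)))).add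
    ((((h1 0).mul (h2 4)).add ((h1 1).mul (h2 5))).add (((h1 2).mul (h2 3)).C_mul 2))

theorem pderiv_loopCubic_zero : pderiv 0 loopCubic =
    (2 : ℂ) • (X 1 * X 2) + (4 : ℂ) • (X 0 * X 3) + X 4 * X 4 := by
  simp [loopCubic, Derivation.leibniz, Derivation.leibniz_pow, pderiv_X, smul_eq_C_mul]
  simp only [show (C 2 : MvPolynomial (Fin 6) ℂ) = 2 from map_ofNat C 2,
    show (C 4 : MvPolynomial (Fin 6) ℂ) = 4 from map_ofNat C 4]
  ring

theorem pderiv_loopCubic_one : pderiv 1 loopCubic =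
    (2 : ℂ) • (X 0 * X 2) + (2 : ℂ) • (X 1 * X 4) + X 5 * X 5 := by
  simp [loopCubic, Derivation.leibniz, Derivation.leibniz_pow, pderiv_X, smul_eq_C_mul]
  simp only [show (C 2 : MvPolynomial (Fin 6) ℂ) = 2 from map_ofNat C 2]
  ring

theorem pderiv_loopCubic_two : pderiv 2 loopCubic =
    (2 : ℂ) • (X 0 * X 1) + (2 : ℂ) • (X 2 * X 5) + (2 : ℂ) • (X 3 * X 3) := by
  simp [loopCubic, Derivation.leibniz, Derivation.leibniz_pow, pderiv_X, smul_eq_C_mul]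
  simp only [show (C 2 : MvPolynomial (Fin 6) ℂ) = 2 from map_ofNat C 2]
  ring

theorem quadricMatrix_polar_loopCubic (y : Fin 3 → ℂ) :
    quadricMatrix (∑ k, y k • pderiv (Fin.castLE (by decide) k : Fin 6) loopCubic) =
      !![0, y 2, y 1, 2 * y 0, 0, 0;
        y 2, 0, y 0, 0, y 1, 0;
        y 1, y 0, 0, 0, 0, y 2;
        2 * y 0, 0, 0, 2 * y 2, 0, 0;
        0, y 1, 0, 0, y 0, 0;
        0, 0, y 2, 0, 0, y 1] := by
  rw [Fin.sum_univ_three]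
  change quadricMatrixₗ (y 0 • pderiv 0 loopCubic + y 1 • pderiv 1 loopCubic +
    y 2 • pderiv 2 loopCubic) = _
  rw [pderiv_loopCubic_zero, pderiv_loopCubic_one, pderiv_loopCubic_two]
  simp only [map_add, map_smul, quadricMatrixₗ_apply, quadricMatrix_X_mul_X]
  ext i j
  fin_cases i <;> fin_cases j <;> simp <;> ring

/-- The lower right 3×3 block is diagonal, and its Schur complement shows the shape. The
coefficients of `loopCubic` are chosen so that the two contributions to `λ²μ²ν²` cancel, leaving
only the loop. -/
theorem discriminantForm_polar_loopCubic :
    discriminantForm (fun k => pderiv (Fin.castLE (by decide) k : Fin 6) loopCubic) =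
      C 4 * (X 0 ^ 5 * X 1) + C 2 * (X 1 ^ 5 * X 2) + C 2 * (X 2 ^ 5 * X 0) := by
  refine MvPolynomial.funext fun y => ?_
  rw [eval_discriminantForm, quadricMatrix_polar_loopCubic]
  simp [Matrix.det_succ_row_zero, Fin.sum_univ_succ, Fin.succAbove]
  ring

theorem isNonsingular_discriminantForm_polar_loopCubic : IsNonsingular (discriminantForm
    (fun k => pderiv (Fin.castLE (by decide) k : Fin 6) loopCubic)) := by
  rw [discriminantForm_polar_loopCubic]
  intro y hy
  by_contra! h
  have h0 := h 0
  have h1 := h 1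
  have h2 := h 2
  simp [Derivation.leibniz, Derivation.leibniz_pow, pderiv_X] at h0 h1 h2
  -- The equations `y i * h i` form a linear system in the three loop monomials, of determinant
  -- 2016; these multipliers solve it for the first monomial.
  have hmul : y 0 ^ 5 * y 1 = 0 := by
    linear_combination (25 / 504 * y 0) * h0 + (1 / 504 * y 1) * h1 - (5 / 504 * y 2) * h2
  have hzero : y 0 = 0 ∧ y 1 = 0 ∧ y 2 = 0 := by
    rcases mul_eq_zero.1 hmul with h | h
    · have e0 : y 0 = 0 := eq_zero_of_pow_eq_zero h
      simp [e0] at h0 h2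
      exact ⟨e0, h2, h0⟩
    · simp [h] at h0 h1
      exact ⟨h1, h, h0⟩
  refine hy (funext fun i => ?_)
  fin_cases i
  exacts [hzero.1, hzero.2.1, hzero.2.2]

theorem isNonsingular_sum_X_pow_three :
    IsNonsingular (∑ i, X i ^ 3 : MvPolynomial (Fin 6) ℂ) := by
  intro y hy
  obtain ⟨i, hi⟩ := Function.ne_iff.1 hy
  refine ⟨i, ?_⟩
  rw [map_sum, Finset.sum_eq_single i]
  · simpa [Derivation.leibniz_pow] using hi
  · intro j _ hj
    simp [Derivation.leibniz_pow, pderiv_X_of_ne hj]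
  · simp

end Example

/-! ### From one good net to an open set of nets, and the main theorem. -/

theorem Gr.linearIndependent_basis {k : ℕ} {K V : Type*} [Field K] [AddCommGroup V] [Module K V]
    (N : Gr k K V) : LinearIndependent K fun i => (N.basis i : V) :=
  N.basis.linearIndependent.map' N.1.subtype N.1.ker_subtype

theorem exists_rep_plucker_eq {k : ℕ} {K V : Type*} [Field K] [AddCommGroup V] [Module K V]
    (N : Gr k K V) : ∃ a : Kˣ, (plucker k K V N).rep =
      (a : K) • exteriorPower.ιMulti K k fun i => (N.basis i : V) :=
  (Projectivization.exists_smul_eq_mk_rep K _ _).imp fun _ h => h.symm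

/-- A net of polar quadrics with nonsingular discriminant form deforms to a nonempty open set of
nets with smooth discriminant curve. -/
theorem exists_isOpen_hasSmoothDiscriminantSextic {F : MvPolynomial (Fin 6) ℂ}
    {Q : Fin 3 → polarSpace F}
    (hQ : IsNonsingular (discriminantForm fun k => (Q k : MvPolynomial (Fin 6) ℂ))) :
    ∃ G : Set (Gr 3 ℂ (polarSpace F)), IsOpen[grTopology 3 ℂ (polarSpace F)] G ∧ G.Nonempty ∧
      ∀ N ∈ G, HasSmoothDiscriminantSextic N := by
  have : FiniteDimensional ℂ (polarSpace F) := by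
    unfold polarSpace; infer_instance
  have hli : LinearIndependent ℂ Q := LinearIndependent.of_comp (polarSpace F).subtype
    (linearIndependent_of_isNonsingular_discriminantForm hQ)
  obtain ⟨N₀, hN₀⟩ : ∃ N₀ : Gr 3 ℂ (polarSpace F), N₀.1 = Submodule.span ℂ (Set.range Q) :=
    ⟨⟨_, FiniteDimensional.span_of_finite ℂ (Set.finite_range Q), by
      rw [finrank_span_eq_card hli, Fintype.card_fin]⟩, rfl⟩
  have hb := isNonsingular_discriminantForm_basis (W := N₀.1)
    (fun k => by rw [hN₀]; exact Submodule.subset_span ⟨k, rfl⟩) hQ N₀.basis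
  obtain ⟨c, hc, hcb⟩ := exists_contraction N₀.linearIndependent_basis
  let L : Fin 3 → (⋀[ℂ]^3 (polarSpace F)) →ₗ[ℂ] MvPolynomial (Fin 6) ℂ :=
    fun k => (polarSpace F).subtype ∘ₗ c k
  have h₀ : IsNonsingular (discriminantForm fun k =>
      L k (plucker 3 ℂ (polarSpace F) N₀).rep) := by
    obtain ⟨a, ha⟩ := exists_rep_plucker_eq N₀
    -- The chosen representative is `a` times the wedge of the basis, so the contractions return `a`
    -- times the basis: a scalar substitution.
    have h := (isNonsingular_discriminantForm_sum_smul_iff ((a : ℂ) • 1) _).2 ⟨by simp, hb⟩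
    convert h using 2
    ext1 k
    rw [ha, map_smul]
    simp only [L, LinearMap.comp_apply]
    rw [hcb]
    simp [Matrix.one_apply]
  obtain ⟨d, f, hf, hf₀, hfD⟩ := exists_homogeneousMap_isNonsingular
    (discriminantForm_mem_homogeneousMaps L) (fun _ => isHomogeneous_discriminantForm _) h₀
  refine ⟨plucker 3 ℂ (polarSpace F) ⁻¹' {x | f x.rep ≠ 0},
    ⟨_, isOpen_setOf_rep_ne_zero hf, rfl⟩, ⟨N₀, hf₀⟩, fun N hN b => ?_⟩
  -- The contracted vectors lie in `N`, so their nonsingular discriminant passes to every basis of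
  -- `N`.
  refine (isNonsingular_discriminantForm_basis (Q := fun k => c k (plucker 3 ℂ _ N).rep)
    (fun k => ?_) (hfD _ hN) b).isSmoothHypersurface (isHomogeneous_discriminantForm _)
  obtain ⟨a, ha⟩ := exists_rep_plucker_eq N
  rw [ha, map_smul]
  refine Submodule.smul_mem _ _ (Submodule.span_le.2 ?_ (hc k _))
  rintro _ ⟨i, rfl⟩
  exact (N.basis i).2

end PolarNets

end

open PolarNets MvPolynomial in
theorem mainTheorem11 :
    ∃ U : Set (ℙ ℂ PolarNets.CubicForm),
      IsOpen[PolarNets.zariskiTopology ℂ PolarNets.CubicForm] U ∧ U.Nonempty ∧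
      ∀ (F : PolarNets.CubicForm) (hF : F ≠ 0), Projectivization.mk ℂ F hF ∈ U →
        PolarNets.IsSmoothHypersurface 3 (F : MvPolynomial (Fin 6) ℂ) ∧
        ∃ G : Set (PolarNets.Gr 3 ℂ (PolarNets.polarSpace (F : MvPolynomial (Fin 6) ℂ))),
          IsOpen[PolarNets.grTopology 3 ℂ (PolarNets.polarSpace (F : MvPolynomial (Fin 6) ℂ))] G ∧
          G.Nonempty ∧
          ∀ N ∈ G, PolarNets.HasSmoothDiscriminantSextic N := by
  have : FiniteDimensional ℂ CubicForm := Module.Finite.iff_fg.2 (homogeneousSubmodule_fg (Fin 6) ℂ 3)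
  let L : Fin 3 → CubicForm →ₗ[ℂ] MvPolynomial (Fin 6) ℂ := fun k =>
    (pderiv (Fin.castLE (by decide) k : Fin 6)).toLinearMap ∘ₗ
      (homogeneousSubmodule (Fin 6) ℂ 3).subtype
  -- A second witness is needed: all polars of the Fermat cubic are diagonal, so their discriminants
  -- are products of six linear forms, hence never smooth.
  let F₁ : CubicForm := ⟨∑ i, X i ^ 3, IsHomogeneous.sum _ _ _ fun i _ => isHomogeneous_X_pow i 3⟩
  let F₂ : CubicForm := ⟨loopCubic, isHomogeneous_loopCubic⟩
  obtain ⟨d, f, hf, hf₁, hfF⟩ := exists_homogeneousMap_isNonsingular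
    (D := fun F : CubicForm => (F : MvPolynomial (Fin 6) ℂ)) (d := 2) (x₀ := F₁)
    (linear_mem_homogeneousMaps ⟨fun _ _ => rfl, fun _ _ => rfl⟩) (fun F => F.2)
    isNonsingular_sum_X_pow_three
  obtain ⟨e, g, hg, hg₂, hgF⟩ := exists_homogeneousMap_isNonsingular
    (discriminantForm_mem_homogeneousMaps L) (fun _ => isHomogeneous_discriminantForm _)
    (x₀ := F₂) isNonsingular_discriminantForm_polar_loopCubic
  have hfg := SetLike.mul_mem_graded hf hg
  refine ⟨{x | (f * g) x.rep ≠ 0}, isOpen_setOf_rep_ne_zero hfg, ?_, fun F hF hFU => ?_⟩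
  · obtain ⟨F, h₁, h₂⟩ := exists_ne_zero_and_ne_zero hf hg hf₁ hg₂
    have hF : F ≠ 0 := by
      rintro rfl
      obtain ⟨i, hi⟩ := hfF 0 h₁ 1 one_ne_zero
      simp at hi
    exact ⟨Projectivization.mk ℂ F hF, (rep_mk_ne_zero_iff hfg hF).2 (mul_ne_zero h₁ h₂)⟩
  · have h := (rep_mk_ne_zero_iff hfg hF).1 hFU
    refine ⟨(hfF F (left_ne_zero_of_mul h)).isSmoothHypersurface F.2, ?_⟩
    -- The starting net is spanned by the polars of the first three coordinate points, whose
    -- discriminant is nonsingular where `g F ≠ 0`.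
    exact exists_isOpen_hasSmoothDiscriminantSextic (Q := fun k => ⟨L k F, by
      exact ⟨Pi.single (Fin.castLE (by decide) k : Fin 6) 1, by
        simp [Fintype.linearCombination_apply_single, L]⟩⟩)
      (hgF F (right_ne_zero_of_mul h))
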